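/- Let $n\ge 1$. A set $\Omega\subseteq\mathbb R^n$ is called Lipschitz if for every $x\in\partial\Omega$ there are $r>0$, a Lipschitz function $G:\mathbb R^{n-1}\to\mathbb R$ and an isometry $A:\mathbb R^n\to\mathbb R^n$ with $A(0)=x$ such that $$B_r(x)\cap\Omega=B_r(x)\cap A\{(y',y_n)\in\mathbb R^{n-1}\times\mathbb R:\ y_n<G(y')\}.$$ A map $\Phi$ is bilipschitz on $\omega$ if there is $L>0$ with $\frac1L|x-y|\le|\Phi(x)-\Phi(y)|\le L|x-y|$ for all $x,y\in\omega$. **Theorem 3.1.** Let $\Omega\subseteq\mathbb R^n$ be a bounded Lipschitz set. Then there are an open set $\omega\subseteq\mathbb R^n$ with $\partial\Omega\subseteq\omega$ and a bijective bilipschitz map $\Phi:\omega\to\omega$ such that $$\Phi(x)=x\ \text{ for all } x\in\partial\Omega,\qquad \Phi(\omega\cap\Omega)=\omega\setminus\overline\Omega,\qquad \Phi(\omega\setminus\overline\Omega)=\omega\cap\Omega.$$ Moreover, $\omega$ and $\Phi$ can be chosen so that there are $\varepsilon>0$, $\gamma>0$ and a field $\psi\in C^\infty_c(\mathbb R^n;\mathbb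 R^n)$ with $|\psi|=1$ on $\partial\Omega$ and with the following properties. For $\mathcal H^{n-1}$-almost every $x\in\partial\Omega$, the outer unit normal $\nu(x)$ of $\Omega$ exists and $\psi(x)\cdot\nu(x)\ge\gamma$. Furthermore $$\omega=\{x+t\psi(x):\ x\in\partial\Omega,\ |t|<\varepsilon\},$$ and $\Phi(x+t\psi(x))=x-t\psi(x)$ for all $x\in\partial\Omega$ and all $t$ with $|t|<\varepsilon$. Here a unit vector $\nu$ is the outer unit normal of $\Omega$ at $x$ if for every $\eta>0$ all $y$ in some neighbourhood of $x$ satisfy: $(y-x)\cdot\nu<-\eta|y-x|$ implies $y\in\Omega$, and $(y-x)\cdot\nu>\eta|y-x|$ implies $y\notin\Omega$. -/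

import Mathlib

open scoped RealInnerProductSpace Topology

/-- The open region of `ℝ^d × ℝ = ℝ^(d+1)` that lies strictly below the graph of `G : ℝ^d → ℝ`,
the last coordinate being the vertical one. -/
def subgraph {d : ℕ} (G : EuclideanSpace ℝ (Fin d) → ℝ) : Set (EuclideanSpace ℝ (Fin (d + 1))) :=
  {z | z (Fin.last d) < G (WithLp.toLp 2 fun i : Fin d => z i.castSucc)}

/-- Lipschitz sets of `ℝ^(d+1)`: around each boundary point `x`, the set agrees with the isometric
image of the region below the graph of a (globally) Lipschitz function, the isometry taking
`0` to `x`. -/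
def IsLipschitzSet {d : ℕ} (Ω : Set (EuclideanSpace ℝ (Fin (d + 1)))) : Prop :=
  ∀ x ∈ frontier Ω, ∃ r : ℝ, 0 < r ∧
    ∃ G : EuclideanSpace ℝ (Fin d) → ℝ, (∃ K : NNReal, LipschitzWith K G) ∧
      ∃ A : EuclideanSpace ℝ (Fin (d + 1)) ≃ᵢ EuclideanSpace ℝ (Fin (d + 1)),
        A 0 = x ∧ Metric.ball x r ∩ Ω = Metric.ball x r ∩ A '' subgraph G

/-- `f` is bilipschitz on `S`: `|x - y| / L ≤ |f x - f y| ≤ L |x - y|` on `S`, for some `L > 0`. -/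
def IsBilipschitzOn {d : ℕ}
    (f : EuclideanSpace ℝ (Fin d) → EuclideanSpace ℝ (Fin d))
    (S : Set (EuclideanSpace ℝ (Fin d))) : Prop :=
  ∃ L : ℝ, 0 < L ∧ ∀ x ∈ S, ∀ y ∈ S,
    1 / L * ‖x - y‖ ≤ ‖f x - f y‖ ∧ ‖f x - f y‖ ≤ L * ‖x - y‖

/-- `ν` is the outer unit normal of `Ω` at `x`: to first order at `x`, the set `Ω` is the half-space
`{y | ⟪y - x, ν⟫ < 0}`, that is, every closed cone inside the open half-space `⟪y - x, ν⟫ < 0`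
(resp. `⟪y - x, ν⟫ > 0`) lies in `Ω` (resp. in its complement) near its vertex `x`.
If `Ω` is near `x` the region below the graph of a Lipschitz function `G`, this says that `G` is
differentiable at the point below `x` and that `ν = (-∇G, 1) / √(1 + |∇G|²)`. -/
def IsOuterUnitNormal {d : ℕ} (Ω : Set (EuclideanSpace ℝ (Fin d)))
    (x ν : EuclideanSpace ℝ (Fin d)) : Prop :=
  ‖ν‖ = 1 ∧ ∀ η : ℝ, 0 < η → ∀ᶠ y in 𝓝 x,
    (⟪y - x, ν⟫ < -(η * ‖y - x‖) → y ∈ Ω) ∧ (η * ‖y - x‖ < ⟪y - x, ν⟫ → y ∉ Ω)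

/-- `ψ` is a smooth transversal field for `Ω`: it is smooth with compact support, of unit length on
the boundary, and for some `γ > 0`, at almost every boundary point (for the `(d-1)`-dimensional
Hausdorff measure, `d` being the dimension of the space) the outer unit normal `ν` exists and
`ψ · ν ≥ γ`. -/
def IsSmoothTransversalField {d : ℕ} (Ω : Set (EuclideanSpace ℝ (Fin d)))
    (ψ : EuclideanSpace ℝ (Fin d) → EuclideanSpace ℝ (Fin d)) : Prop :=
  ContDiff ℝ (⊤ : ℕ∞) ψ ∧ HasCompactSupport ψ ∧ (∀ x ∈ frontier Ω, ‖ψ x‖ = 1) ∧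
    ∃ γ : ℝ, 0 < γ ∧
      ∀ᵐ x ∂((MeasureTheory.Measure.hausdorffMeasure ((d : ℝ) - 1) :
          MeasureTheory.Measure (EuclideanSpace ℝ (Fin d))).restrict (frontier Ω)),
        ∃ ν, IsOuterUnitNormal Ω x ν ∧ γ ≤ ⟪ψ x, ν⟫

/-! The proof rests on a notion of outward vector: `v` is outward at `x` if, for all `z ∉ Ω` near
`x`, all `w` near `v` and all small `t > 0`, the point `z + t • w` avoids `closure Ω`. The vertical
direction of a Lipschitz graph is outward, since a steep enough step outruns the graph. Outward
vectors form a convex cone and stay outward at nearby points, so local choices glue to a smooth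
field `ψ`, normalised on the boundary; compactness makes the radius uniform. Two boundary points
cannot be joined by a short segment in a direction close to `ψ`. Hence `(x, t) ↦ x + t • ψ x` is
bounded below on boundary times interval (`exists_tube_lower_bound`). Its image is a neighbourhood
of each boundary point by a contraction argument and connectedness (`tube_mem_nhds`). In these
bi-Lipschitz coordinates `Φ` is `t ↦ -t`, and the sign of `t` decides the side of the boundary.
Normals exist almost everywhere by Rademacher's theorem in graph charts. Tilting `ψ` by `-(r / 2) •
ν` keeps it within the outward radius `r`, which forces `⟪ψ, ν⟫ ≥ r / 2`. -/

open Metric Set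

/-! ### Outward directions: a convex cone, stable under perturbation -/

section Outward

variable {E : Type*} [NormedAddCommGroup E] [NormedSpace ℝ E]

/-- Moving from a point near `x` outside `Ω` a distance less than `r` along a vector close to `v`
leads outside the closure of `Ω`; `r` measures the closeness. -/
def HasOutwardRadius (Ω : Set E) (r : ℝ) (x v : E) : Prop :=
  ∀ z ∈ ball x r, ∀ w ∈ ball v r, ∀ t ∈ Ioo 0 r, z ∉ Ω → z + t • w ∉ closure Ω

/-- The vector `v` points out of `Ω` near `x`, uniformly. -/
def IsOutward (Ω : Set E) (x v : E) : Prop :=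
  ∃ r : ℝ, 0 < r ∧ HasOutwardRadius Ω r x v

variable {Ω : Set E} {r : ℝ} {x v : E}

theorem HasOutwardRadius.mono {s : ℝ} (h : HasOutwardRadius Ω r x v) (hs : s ≤ r) :
    HasOutwardRadius Ω s x v := fun z hz w hw t ht =>
  h z (ball_subset_ball hs hz) w (ball_subset_ball hs hw) t ⟨ht.1, ht.2.trans_le hs⟩

theorem HasOutwardRadius.half {y u : E} (h : HasOutwardRadius Ω r x v)
    (hy : y ∈ ball x (r / 2)) (hu : u ∈ ball v (r / 2)) : HasOutwardRadius Ω (r / 2) y u := by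
  intro z hz w hw t ht
  have hr : 0 < r := by linarith [ht.1.trans ht.2]
  refine h z ?_ w ?_ t ⟨ht.1, by linarith [ht.2]⟩
  · rw [mem_ball] at *
    linarith [dist_triangle z y x]
  · rw [mem_ball] at *
    linarith [dist_triangle w u v]

theorem IsOutward.eventually (h : IsOutward Ω x v) : ∀ᶠ y in 𝓝 x, IsOutward Ω y v := by
  obtain ⟨r, hr, h⟩ := h
  filter_upwards [ball_mem_nhds x (half_pos hr)] with y hy
  exact ⟨r / 2, half_pos hr, h.half hy (mem_ball_self (half_pos hr))⟩

theorem IsOutward.smul {a : ℝ} (ha : 0 < a) (h : IsOutward Ω x v) : IsOutward Ω x (a • v) := by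
  obtain ⟨r, hr, h⟩ := h
  refine ⟨min r (min (a * r) (r / a)), by positivity, fun z hz w hw t ht hzΩ => ?_⟩
  have key := h z (ball_subset_ball (min_le_left _ _) hz) (a⁻¹ • w) ?_ (a * t) ⟨?_, ?_⟩ hzΩ
  · rwa [smul_smul, mul_assoc, mul_comm t, ← mul_assoc, mul_inv_cancel₀ ha.ne', one_mul] at key
  · have hw' : ‖w - a • v‖ < a * r := by
      rw [← dist_eq_norm]
      exact lt_of_lt_of_le hw ((min_le_right _ _).trans (min_le_left _ _))
    have e : a⁻¹ • w - v = a⁻¹ • (w - a • v) := by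
      rw [smul_sub, smul_smul, inv_mul_cancel₀ ha.ne', one_smul]
    rw [mem_ball, dist_eq_norm, e, norm_smul, norm_inv, Real.norm_of_nonneg ha.le,
      inv_mul_lt_iff₀ ha]
    exact hw'
  · exact mul_pos ha ht.1
  · rw [mul_comm, ← lt_div_iff₀ ha]
    exact lt_of_lt_of_le ht.2 ((min_le_right _ _).trans (min_le_right _ _))

/-- Step first along `u`, which leaves `z` outside `Ω`, then along `w - u`, which is close to `v`.
-/
theorem IsOutward.add {u : E} (hu : IsOutward Ω x u) (hv : IsOutward Ω x v) :
    IsOutward Ω x (u + v) := by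
  obtain ⟨r, hr, hu⟩ := hu
  obtain ⟨s, hs, hv⟩ := hv
  set m := min r s with hm
  have hm0 : 0 < m := lt_min hr hs
  replace hu := hu.mono (min_le_left r s)
  replace hv := hv.mono (min_le_right r s)
  rw [← hm] at hu hv
  -- The radius absorbs the first step: `z + t • u` moves by at most `q * ‖u‖` and must remain
  -- within `m` of `x`.
  set q := m / (2 * (m + 1 + ‖u‖)) with hq
  have hu0 := norm_nonneg u
  have hq0 : 0 < q := by positivity
  have hqm : q * (m + 1 + ‖u‖) = m / 2 := by rw [hq]; field_simp
  have hq1 : q ≤ m / 2 := by nlinarith [mul_nonneg hq0.le hu0, mul_nonneg hq0.le hm0.le]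
  refine ⟨q, hq0, fun z hz w hw t ht hzΩ => ?_⟩
  rw [mem_ball, dist_eq_norm] at hz hw
  have h1 : z + t • u ∉ Ω := fun hmem =>
    hu z (by rw [mem_ball, dist_eq_norm]; linarith) u (mem_ball_self hm0) t
      ⟨ht.1, by linarith [ht.2]⟩ hzΩ (subset_closure hmem)
  have h2 := hv (z + t • u) ?_ (w - u) ?_ t ⟨ht.1, by linarith [ht.2]⟩ h1
  · rwa [add_assoc, ← smul_add, add_sub_cancel] at h2
  · rw [mem_ball, dist_eq_norm, add_sub_right_comm]
    have : ‖t • u‖ ≤ q * ‖u‖ := by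
      rw [norm_smul, Real.norm_of_nonneg ht.1.le]
      gcongr
      exact ht.2.le
    nlinarith [norm_add_le (z - x) (t • u), mul_pos hq0 hm0]
  · rw [mem_ball, dist_eq_norm, sub_sub]
    linarith

/-- Convexity is what allows a partition of unity to glue local choices. -/
theorem convex_isOutward (Ω : Set E) (x : E) : Convex ℝ {v | IsOutward Ω x v} :=
  convex_iff_forall_pos.2 fun _ hu _ hv _ _ ha hb _ => (hu.smul ha).add (hv.smul hb)

theorem IsOutward.ne_zero (hx : x ∈ closure Ω) (hx' : x ∉ Ω) (h : IsOutward Ω x v) : v ≠ 0 := by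
  rintro rfl
  obtain ⟨r, hr, h⟩ := h
  refine h x (mem_ball_self hr) 0 (mem_ball_self hr) (r / 2) ⟨by linarith, by linarith⟩ hx' ?_
  simpa using hx

theorem exists_uniform_hasOutwardRadius {K : Set E} (hK : IsCompact K) {ψ : E → E}
    (hψ : Continuous ψ) (h : ∀ x ∈ K, IsOutward Ω x (ψ x)) :
    ∃ r : ℝ, 0 < r ∧ ∀ x ∈ K, HasOutwardRadius Ω r x (ψ x) := by
  refine hK.induction_on (p := fun S => ∃ r : ℝ, 0 < r ∧ ∀ x ∈ S, HasOutwardRadius Ω r x (ψ x))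
    ⟨1, one_pos, by simp⟩ ?_ ?_ ?_
  · rintro S T hST ⟨r, hr, hT⟩
    exact ⟨r, hr, fun x hx => hT x (hST hx)⟩
  · rintro S T ⟨r, hr, hS⟩ ⟨s, hs, hT⟩
    refine ⟨min r s, lt_min hr hs, ?_⟩
    rintro x (hx | hx)
    exacts [(hS x hx).mono (min_le_left _ _), (hT x hx).mono (min_le_right _ _)]
  · intro x hx
    obtain ⟨r, hr, h⟩ := h x hx
    refine ⟨ball x (r / 2) ∩ ψ ⁻¹' ball (ψ x) (r / 2), mem_nhdsWithin_of_mem_nhds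
      (Filter.inter_mem (ball_mem_nhds _ (half_pos hr))
        (hψ.continuousAt (ball_mem_nhds _ (half_pos hr)))), r / 2, half_pos hr, ?_⟩
    exact fun y hy => h.half hy.1 hy.2

end Outward

/-! ### Coordinates along a transversal field -/

section Tube

variable {E : Type*} [NormedAddCommGroup E] [NormedSpace ℝ E]
  {Ω : Set E} {ψ : E → E} {r : ℝ}

/-- If `x - t • v` were outside `Ω`, the step `t • v` would carry it to `x`, which lies in the
closure. -/
theorem HasOutwardRadius.sub_smul_mem {x v : E} (h : HasOutwardRadius Ω r x v)
    (hx : x ∈ closure Ω) (hv : ‖v‖ = 1) {t : ℝ} (ht : 0 < t) (htr : t < r) : x - t • v ∈ Ω := by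
  by_contra hn
  refine h (x - t • v) ?_ v (mem_ball_self (ht.trans htr)) t ⟨ht, htr⟩ hn (by simpa using hx)
  simpa [mem_ball, dist_eq_norm, norm_smul, hv, abs_of_pos ht] using htr

theorem HasOutwardRadius.add_smul_notMem {x v : E} (h : HasOutwardRadius Ω r x v)
    (hx : x ∉ Ω) {t : ℝ} (ht : 0 < t) (htr : t < r) : x + t • v ∉ closure Ω :=
  h x (mem_ball_self (ht.trans htr)) v (mem_ball_self (ht.trans htr)) t ⟨ht, htr⟩ hx

/-- If the estimate failed, `y = x + τ • w` with `w` within `r` of `v`. An outward step from `x` to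
`y` (or from `y` to `x` when `τ < 0`) would then end outside `closure Ω`, yet both points lie in it.
-/
theorem HasOutwardRadius.mul_abs_le {x y v : E} (h : HasOutwardRadius Ω r x v)
    (hv : ‖v‖ = 1) (hx : x ∈ closure Ω) (hx' : x ∉ Ω) (hy : y ∈ closure Ω) (hy' : y ∉ Ω)
    {τ : ℝ} (hr : 0 < r) (hτ : |τ| * (1 + r) < r) :
    r * |τ| ≤ ‖x - y + τ • v‖ := by
  by_contra! hlt
  set u := x - y + τ • v with hu
  have hτ0 : τ ≠ 0 := by
    rintro rfl
    simp only [abs_zero, mul_zero] at hlt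
    exact absurd hlt (norm_nonneg _).not_gt
  have hτp : 0 < |τ| := abs_pos.2 hτ0
  have hτr : |τ| < r := by nlinarith
  set w := v - τ⁻¹ • u with hw
  have hwv : ‖w - v‖ < r := by
    rw [hw, sub_sub_cancel_left, norm_neg, norm_smul, norm_inv, Real.norm_eq_abs,
      inv_mul_lt_iff₀ hτp]
    linarith
  have hyx : y = x + τ • w := by
    rw [hw, smul_sub, smul_smul, mul_inv_cancel₀ hτ0, one_smul, hu]
    abel
  have hwm : w ∈ ball v r := by rwa [mem_ball, dist_eq_norm]
  rcases lt_or_gt_of_ne hτ0 with hneg | hpos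
  · refine h y ?_ w hwm (-τ) ⟨by linarith, by rwa [abs_of_neg hneg] at hτr⟩ hy' ?_
    · rw [mem_ball, dist_eq_norm, hyx, add_sub_cancel_left, norm_smul, Real.norm_eq_abs]
      have : ‖w‖ ≤ 1 + r := by
        have := norm_add_le v (w - v)
        rw [add_sub_cancel, hv] at this
        linarith
      nlinarith
    · rw [hyx, add_assoc, ← add_smul]
      simpa using hx
  · refine h x (mem_ball_self hr) w hwm τ ⟨hpos, by rwa [abs_of_pos hpos] at hτr⟩ hx' ?_
    rwa [← hyx]

/-- A transversal Lipschitz field of unit length gives coordinates near the boundary that are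
bounded below. -/
theorem exists_tube_lower_bound (hr : 0 < r) (hΩ : IsOpen Ω)
    (hout : ∀ x ∈ frontier Ω, HasOutwardRadius Ω r x (ψ x))
    (hunit : ∀ x ∈ frontier Ω, ‖ψ x‖ = 1) {M : NNReal} (hM : LipschitzWith M ψ) :
    ∃ ε > 0, ∃ c > 0, ∀ x ∈ frontier Ω, ∀ y ∈ frontier Ω, ∀ t s : ℝ, |t| < ε → |s| < ε →
      c * (‖x - y‖ + |t - s|) ≤ ‖(x + t • ψ x) - (y + s • ψ y)‖ := by
  rw [hΩ.frontier_eq] at *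
  -- With `τ = t - s` and `N = ‖x - y + τ • ψ x‖`, the bounds `r * |τ| ≤ N` and `‖x - y‖ ≤ N + |τ|`
  -- add up to this `c`. Half of it is then spent on replacing `ψ x` by `ψ y`, which the second
  -- bound on `ε` makes cheap.
  set c : ℝ := r / (r + 2) with hc
  have hc0 : 0 < c := by positivity
  refine ⟨min (r / (2 * (1 + r))) (c / (2 * (M + 1))), by positivity, c / 2, by positivity, ?_⟩
  intro x hx y hy t s ht hs
  obtain ⟨ht1, ht2⟩ := lt_min_iff.1 ht
  obtain ⟨hs1, hs2⟩ := lt_min_iff.1 hs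
  rw [lt_div_iff₀ (by positivity)] at ht1 ht2 hs1 hs2
  have hts : |t - s| ≤ |t| + |s| := abs_sub t s
  have h1 := (hout x hx).mul_abs_le (hunit x hx) hx.1 hx.2 hy.1 hy.2 (τ := t - s) hr
    (by nlinarith)
  set N := ‖x - y + (t - s) • ψ x‖ with hN
  have h2 : ‖x - y‖ ≤ N + |t - s| := by
    have := norm_sub_le (x - y + (t - s) • ψ x) ((t - s) • ψ x)
    rwa [add_sub_cancel_right, norm_smul, hunit x hx, mul_one, Real.norm_eq_abs] at this
  have h3 : c * (‖x - y‖ + |t - s|) ≤ N := by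
    rw [hc, div_mul_eq_mul_div, div_le_iff₀ (by positivity)]
    nlinarith
  have h4 : ‖s • (ψ x - ψ y)‖ ≤ c / 2 * ‖x - y‖ := by
    rw [norm_smul, Real.norm_eq_abs]
    have := hM.dist_le_mul x y
    rw [dist_eq_norm, dist_eq_norm] at this
    calc |s| * ‖ψ x - ψ y‖ ≤ |s| * (M * ‖x - y‖) := by gcongr
      _ = (|s| * M) * ‖x - y‖ := by ring
      _ ≤ c / 2 * ‖x - y‖ := by
        gcongr
        nlinarith [abs_nonneg s]
  have e : (x + t • ψ x) - (y + s • ψ y) = (x - y + (t - s) • ψ x) + s • (ψ x - ψ y) := by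
    rw [smul_sub, sub_smul]
    abel
  rw [e]
  have h5 := norm_sub_le (x - y + (t - s) • ψ x + s • (ψ x - ψ y)) (s • (ψ x - ψ y))
  rw [add_sub_cancel_right] at h5
  nlinarith [mul_nonneg hc0.le (abs_nonneg (t - s))]

theorem IsPreconnected.exists_mem_frontier {X : Type*} [TopologicalSpace X] {S U : Set X}
    (hS : IsPreconnected S) (hU : IsOpen U) (h₁ : (S ∩ U).Nonempty)
    (h₂ : (S ∩ (closure U)ᶜ).Nonempty) : ∃ x ∈ S, x ∈ frontier U := by
  by_contra! h
  obtain ⟨x, -, hx, hx'⟩ := hS U (closure U)ᶜ hU isClosed_closure.isOpen_compl (fun x hx => by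
    by_contra hn
    rw [mem_union, not_or, mem_compl_iff, not_not] at hn
    exact h x hx (hU.frontier_eq ▸ ⟨hn.2, hn.1⟩)) h₁ h₂
  exact hx' (subset_closure hx)

/-- The segments `x + t ψ(x)`, `|t| < ε`, through boundary points `x` fill a neighbourhood of each
boundary point. -/
theorem tube_mem_nhds [CompleteSpace E] (hr : 0 < r) (hΩ : IsOpen Ω)
    {x₀ : E} (hx₀ : x₀ ∈ frontier Ω) (hout : HasOutwardRadius Ω r x₀ (ψ x₀))
    {M : NNReal} (hM : LipschitzWith M ψ) {B : ℝ} (hB : ∀ x, ‖ψ x‖ ≤ B) {ε : ℝ} (hε : 0 < ε) :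
    {y | ∃ x ∈ frontier Ω, ∃ t : ℝ, |t| < ε ∧ y = x + t • ψ x} ∈ 𝓝 x₀ := by
  have hB0 : 0 ≤ B := (norm_nonneg _).trans (hB x₀)
  rw [hΩ.frontier_eq] at hx₀
  -- The four bounds give, in order: parameters below `ε`, `q t` within `r / 4` of `x₀`, contraction
  -- constant at most `1 / 2`, and `ψ (q t)` within `r / 4` of `ψ x₀`.
  set δ : ℝ := min (ε / 2) (min (r / (4 * (1 + B))) (min (1 / (2 * (M + 1)))
    (r / (4 * ((M + 1) * (1 + B)))))) with hδ
  have hδ0 : 0 < δ := by positivity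
  have hδ1 : δ ≤ ε / 2 := min_le_left _ _
  have hδ2 : δ ≤ r / (4 * (1 + B)) := (min_le_right _ _).trans (min_le_left _ _)
  have hδ3 : δ ≤ 1 / (2 * (M + 1)) :=
    (min_le_right _ _).trans ((min_le_right _ _).trans (min_le_left _ _))
  have hδ4 : δ ≤ r / (4 * ((M + 1) * (1 + B))) :=
    (min_le_right _ _).trans ((min_le_right _ _).trans (min_le_right _ _))
  rw [le_div_iff₀ (by positivity)] at hδ2 hδ3 hδ4
  have hδM : δ * M ≤ 1 / 2 := by nlinarith
  set ρ : ℝ := min δ (δ * r / 4) with hρ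
  have hρ0 : 0 < ρ := by positivity
  refine Filter.mem_of_superset (ball_mem_nhds x₀ hρ0) fun p hp => ?_
  rw [mem_ball, dist_eq_norm] at hp
  have hpδ : ‖p - x₀‖ < δ := hp.trans_le (min_le_left _ _)
  have hpr : ‖p - x₀‖ < δ * r / 4 := hp.trans_le (min_le_right _ _)
  -- a path of points whose segment in direction `ψ` reaches `p`
  have hfix : ∀ t : ℝ, |t| ≤ δ → ∃ q, q = p - t • ψ q := by
    intro t ht
    have hcon : ContractingWith (‖t‖₊ * M) fun q => p - t • ψ q := by
      refine ⟨?_, LipschitzWith.of_dist_le_mul fun a b => ?_⟩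
      · rw [← NNReal.coe_lt_coe]
        push_cast
        rw [Real.norm_eq_abs]
        nlinarith [M.coe_nonneg]
      · rw [dist_sub_left, dist_eq_norm, ← smul_sub, norm_smul, NNReal.coe_mul, coe_nnnorm,
          mul_assoc, ← dist_eq_norm]
        gcongr
        exact hM.dist_le_mul a b
    have : Nonempty E := ⟨p⟩
    exact ⟨hcon.fixedPoint, hcon.fixedPoint_isFixedPt.symm⟩
  choose! q hq using hfix
  have hqcont : ContinuousOn q (Icc (-δ) δ) := by
    refine LipschitzOnWith.continuousOn (K := Real.toNNReal (2 * B))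
      (LipschitzOnWith.of_dist_le_mul fun t ht s hs => ?_)
    have ht' := abs_le.2 ht
    have hs' := abs_le.2 hs
    rw [Real.coe_toNNReal _ (by positivity), dist_eq_norm, Real.dist_eq]
    have e : q t - q s = -((t - s) • ψ (q t) + s • (ψ (q t) - ψ (q s))) := by
      conv_lhs => rw [hq t ht', hq s hs']
      rw [sub_smul, smul_sub]
      abel
    have h1 : ‖q t - q s‖ ≤ |t - s| * ‖ψ (q t)‖ + |s| * ‖ψ (q t) - ψ (q s)‖ := by
      conv_lhs => rw [e, norm_neg]
      refine (norm_add_le _ _).trans ?_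
      rw [norm_smul, norm_smul, Real.norm_eq_abs, Real.norm_eq_abs]
    have h2 : |t - s| * ‖ψ (q t)‖ ≤ |t - s| * B := by gcongr; exact hB _
    have h3 : |s| * ‖ψ (q t) - ψ (q s)‖ ≤ δ * (M * ‖q t - q s‖) := by
      have := hM.dist_le_mul (q t) (q s)
      rw [dist_eq_norm, dist_eq_norm] at this
      gcongr
    nlinarith [norm_nonneg (q t - q s)]
  have hdist : ∀ t : ℝ, |t| ≤ δ → ‖q t - x₀‖ ≤ δ * (1 + B) := by
    intro t ht
    have e : q t - x₀ = (p - x₀) - t • ψ (q t) := by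
      conv_lhs => rw [hq t ht]
      abel
    rw [e]
    refine (norm_sub_le _ _).trans ?_
    have : ‖t • ψ (q t)‖ ≤ δ * B := by
      rw [norm_smul, Real.norm_eq_abs]
      gcongr
      exact hB _
    linarith
  have hψ : ∀ t : ℝ, |t| ≤ δ → ‖ψ (q t) - ψ x₀‖ ≤ r / 4 := by
    intro t ht
    have := hM.dist_le_mul (q t) x₀
    rw [dist_eq_norm, dist_eq_norm] at this
    have h1 : M * ‖q t - x₀‖ ≤ M * (δ * (1 + B)) := by gcongr; exact hdist t ht
    nlinarith [mul_nonneg hδ0.le (by linarith : 0 ≤ 1 + B)]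
  -- Since `q t = x₀ - t • (ψ (q t) - t⁻¹ • (p - x₀))`, the points `q (±δ)` and `x₀` differ by a
  -- step of length parameter `δ` along an admissible vector. Thus `q δ` lies in `Ω` and `q (-δ)`
  -- outside its closure, and the path `q` must cross the boundary.
  have hball : ∀ t : ℝ, |t| = δ →
      ψ (q t) - t⁻¹ • (p - x₀) ∈ ball (ψ x₀) r := by
    intro t ht
    rw [mem_ball, dist_eq_norm, sub_right_comm]
    refine (norm_sub_le _ _).trans_lt ?_
    have h1 : ‖t⁻¹ • (p - x₀)‖ < r / 4 := by
      rw [norm_smul, norm_inv, Real.norm_eq_abs, ht, inv_mul_lt_iff₀ hδ0]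
      linarith
    linarith [hψ t ht.le]
  have hδr : δ < r := by nlinarith
  have hpos : q δ ∈ Ω := by
    have hδabs : |δ| = δ := abs_of_pos hδ0
    by_contra hn
    refine hout (q δ) ?_ _ (hball δ hδabs) δ ⟨hδ0, hδr⟩ hn ?_
    · rw [mem_ball, dist_eq_norm]
      linarith [hdist δ hδabs.le]
    · have : q δ + δ • (ψ (q δ) - δ⁻¹ • (p - x₀)) = x₀ := by
        rw [smul_sub, smul_smul, mul_inv_cancel₀ hδ0.ne', one_smul]
        nth_rw 1 [hq δ hδabs.le]
        abel
      rw [this]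
      exact hx₀.1
  have hneg : q (-δ) ∉ closure Ω := by
    have hδabs : |-δ| = δ := by rw [abs_neg, abs_of_pos hδ0]
    have := hout x₀ (mem_ball_self hr) _ (hball (-δ) hδabs) δ ⟨hδ0, hδr⟩ hx₀.2
    have e : q (-δ) = x₀ + δ • (ψ (q (-δ)) - (-δ)⁻¹ • (p - x₀)) := by
      rw [smul_sub, smul_smul, inv_neg, mul_neg, mul_inv_cancel₀ hδ0.ne', neg_smul, one_smul]
      nth_rw 1 [hq (-δ) hδabs.le]
      rw [neg_smul]
      abel
    rwa [e]
  obtain ⟨_, ⟨t, ht, rfl⟩, hfr⟩ := (isPreconnected_Icc.image q hqcont).exists_mem_frontier hΩ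
    ⟨q δ, mem_image_of_mem q ⟨by linarith, le_rfl⟩, hpos⟩
    ⟨q (-δ), mem_image_of_mem q ⟨le_rfl, by linarith⟩, hneg⟩
  have ht' : |t| ≤ δ := abs_le.2 ht
  refine ⟨q t, hfr, t, by linarith, ?_⟩
  nth_rw 1 [hq t ht']
  abel

end Tube

/-! ### The reflection and its bi-Lipschitz bounds -/

section Reflection

variable {E : Type*} [NormedAddCommGroup E] [NormedSpace ℝ E]

/-- The reflection across the boundary along the segments of a transversal field. -/
theorem exists_reflection [CompleteSpace E] {Ω : Set E} (hΩ : IsOpen Ω)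
    (hcpt : IsCompact (frontier Ω)) {ψ : E → E} {M : NNReal} (hM : LipschitzWith M ψ)
    {B : ℝ} (hB : ∀ x, ‖ψ x‖ ≤ B) (hunit : ∀ x ∈ frontier Ω, ‖ψ x‖ = 1)
    (hout : ∀ x ∈ frontier Ω, IsOutward Ω x (ψ x)) :
    ∃ (ω : Set E) (Φ : E → E) (ε : ℝ), 0 < ε ∧
      ω = {y | ∃ x ∈ frontier Ω, ∃ t : ℝ, |t| < ε ∧ y = x + t • ψ x} ∧
      IsOpen ω ∧ frontier Ω ⊆ ω ∧ BijOn Φ ω ω ∧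
      (∃ L : ℝ, 0 < L ∧ ∀ x ∈ ω, ∀ y ∈ ω,
        1 / L * ‖x - y‖ ≤ ‖Φ x - Φ y‖ ∧ ‖Φ x - Φ y‖ ≤ L * ‖x - y‖) ∧
      (∀ x ∈ frontier Ω, Φ x = x) ∧
      Φ '' (ω ∩ Ω) = ω \ closure Ω ∧ Φ '' (ω \ closure Ω) = ω ∩ Ω ∧
      ∀ x ∈ frontier Ω, ∀ t : ℝ, |t| < ε → Φ (x + t • ψ x) = x - t • ψ x := by
  obtain ⟨r, hr, hrad⟩ := exists_uniform_hasOutwardRadius hcpt hM.continuous hout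
  obtain ⟨ε₀, hε₀, c, hc, hlow⟩ := exists_tube_lower_bound hr hΩ hrad hunit hM
  set T : Set E := {y | ∃ x ∈ frontier Ω, ∃ t : ℝ, |t| < ε₀ ∧ y = x + t • ψ x} with hT
  obtain ⟨δ, hδ, hδT⟩ := hcpt.exists_thickening_subset_open (isOpen_interior (s := T))
    fun x hx => mem_interior_iff_mem_nhds.2 (tube_mem_nhds hr hΩ hx (hrad x hx) hM hB hε₀)
  -- `ε₀` gives injective coordinates, `δ` keeps the tube where `T` is a neighbourhood, and `r`
  -- makes the sign of `t` determine the side.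
  set ε : ℝ := min ε₀ (min δ r) with hεdef
  have hε : 0 < ε := by positivity
  have hε1 : ε ≤ ε₀ := min_le_left _ _
  have hε2 : ε ≤ δ := (min_le_right _ _).trans (min_le_left _ _)
  have hε3 : ε ≤ r := (min_le_right _ _).trans (min_le_right _ _)
  set ω : Set E := {y | ∃ x ∈ frontier Ω, ∃ t : ℝ, |t| < ε ∧ y = x + t • ψ x} with hω
  have hinj : ∀ x ∈ frontier Ω, ∀ y ∈ frontier Ω, ∀ t s : ℝ, |t| < ε → |s| < ε →
      x + t • ψ x = y + s • ψ y → x = y ∧ t = s := by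
    intro x hx y hy t s ht hs h
    have h1 := hlow x hx y hy t s (ht.trans_le hε1) (hs.trans_le hε1)
    rw [h, sub_self, norm_zero] at h1
    have h2 : ‖x - y‖ + |t - s| ≤ 0 := by
      by_contra hn
      exact absurd h1 (mul_pos hc (not_le.1 hn)).not_ge
    have h3 := norm_nonneg (x - y)
    have h4 := abs_nonneg (t - s)
    exact ⟨sub_eq_zero.1 (norm_eq_zero.1 (by linarith)),
      sub_eq_zero.1 (abs_eq_zero.1 (by linarith))⟩
  have hchoice : ∀ p ∈ ω, ∃ x, ∃ t : ℝ, x ∈ frontier Ω ∧ |t| < ε ∧ p = x + t • ψ x := by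
    rintro p ⟨x, hx, t, ht, h⟩
    exact ⟨x, t, hx, ht, h⟩
  choose! X τ hX hτ hXτ using hchoice
  set Φ : E → E := fun p => X p - τ p • ψ (X p) with hΦ
  have hmem : ∀ x ∈ frontier Ω, ∀ t : ℝ, |t| < ε → x + t • ψ x ∈ ω :=
    fun x hx t ht => ⟨x, hx, t, ht, rfl⟩
  have hform : ∀ x ∈ frontier Ω, ∀ t : ℝ, |t| < ε → Φ (x + t • ψ x) = x - t • ψ x := by
    intro x hx t ht
    have hm := hmem x hx t ht
    obtain ⟨h1, h2⟩ := hinj _ (hX _ hm) x hx _ t (hτ _ hm) ht (hXτ _ hm).symm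
    simp only [hΦ, h1, h2]
  have hform' : ∀ x ∈ frontier Ω, ∀ t : ℝ, |t| < ε → Φ (x - t • ψ x) = x + t • ψ x := by
    intro x hx t ht
    have := hform x hx (-t) (by rwa [abs_neg])
    rwa [neg_smul, sub_neg_eq_add, ← sub_eq_add_neg] at this
  have hmem' : ∀ x ∈ frontier Ω, ∀ t : ℝ, |t| < ε → x - t • ψ x ∈ ω := by
    intro x hx t ht
    have := hmem x hx (-t) (by rwa [abs_neg])
    rwa [neg_smul, ← sub_eq_add_neg] at this
  have hmaps : MapsTo Φ ω ω := by
    rintro _ ⟨x, hx, t, ht, rfl⟩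
    rw [hform x hx t ht]
    exact hmem' x hx t ht
  have hinv : ∀ p ∈ ω, Φ (Φ p) = p := by
    rintro _ ⟨x, hx, t, ht, rfl⟩
    rw [hform x hx t ht, hform' x hx t ht]
  have hfr : ∀ x ∈ frontier Ω, x ∈ ω := fun x hx => by
    simpa using hmem x hx 0 (by simpa using hε)
  have hpos : ∀ x ∈ frontier Ω, ∀ t : ℝ, 0 < t → t < ε → x + t • ψ x ∉ closure Ω := by
    intro x hx t h0 ht
    have hx' := hx
    rw [hΩ.frontier_eq] at hx'
    exact (hrad x hx).add_smul_notMem hx'.2 h0 (ht.trans_le hε3)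
  have hneg : ∀ x ∈ frontier Ω, ∀ t : ℝ, 0 < t → t < ε → x - t • ψ x ∈ Ω := fun x hx t h0 ht =>
    (hrad x hx).sub_smul_mem (frontier_subset_closure hx) (hunit x hx) h0 (ht.trans_le hε3)
  have hside₁ : MapsTo Φ (ω ∩ Ω) (ω \ closure Ω) := by
    rintro _ ⟨⟨x, hx, t, ht, rfl⟩, hin⟩
    obtain ⟨h1, h2⟩ := abs_lt.1 ht
    refine ⟨hmaps (hmem x hx t ht), ?_⟩
    rw [hform x hx t ht]
    rcases lt_trichotomy t 0 with h | rfl | h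
    · have := hpos x hx (-t) (by linarith) (by linarith)
      rwa [neg_smul, ← sub_eq_add_neg] at this
    · rw [hΩ.frontier_eq] at hx
      exact absurd (by simpa using hin) hx.2
    · exact absurd (subset_closure hin) (hpos x hx t h h2)
  have hside₂ : MapsTo Φ (ω \ closure Ω) (ω ∩ Ω) := by
    rintro _ ⟨⟨x, hx, t, ht, rfl⟩, hin⟩
    obtain ⟨h1, h2⟩ := abs_lt.1 ht
    refine ⟨hmaps (hmem x hx t ht), ?_⟩
    rw [hform x hx t ht]
    rcases lt_trichotomy t 0 with h | rfl | h
    · have := hneg x hx (-t) (by linarith) (by linarith)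
      rw [neg_smul, sub_neg_eq_add] at this
      exact absurd (subset_closure this) hin
    · exact absurd (frontier_subset_closure hx) (by simpa using hin)
    · exact hneg x hx t h h2
  -- In the coordinates `(x, t)` the reflected point varies with constant `1 + ε * M`; returning to
  -- the ambient distance costs `1 / c`. The lower bound follows because `Φ` is an involution.
  set L : ℝ := (1 + ε * M) / c with hL
  have hL0 : 0 < L := by positivity
  have hlip : ∀ p ∈ ω, ∀ q ∈ ω, ‖Φ p - Φ q‖ ≤ L * ‖p - q‖ := by
    rintro _ ⟨x, hx, t, ht, rfl⟩ _ ⟨y, hy, s, hs, rfl⟩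
    rw [hform x hx t ht, hform y hy s hs]
    have h1 := hlow x hx y hy t s (ht.trans_le hε1) (hs.trans_le hε1)
    have e : x - t • ψ x - (y - s • ψ y) = (x - y) - (t - s) • ψ x - s • (ψ x - ψ y) := by
      rw [sub_smul, smul_sub]
      abel
    have h2 : ‖s • (ψ x - ψ y)‖ ≤ ε * (M * ‖x - y‖) := by
      have := hM.dist_le_mul x y
      rw [dist_eq_norm, dist_eq_norm] at this
      rw [norm_smul, Real.norm_eq_abs]
      gcongr
    have h3 : ‖(t - s) • ψ x‖ = |t - s| := by
      rw [norm_smul, hunit x hx, mul_one, Real.norm_eq_abs]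
    calc ‖x - t • ψ x - (y - s • ψ y)‖
        ≤ ‖x - y‖ + |t - s| + ε * (M * ‖x - y‖) := by
          rw [e]
          refine (norm_sub_le _ _).trans (add_le_add ((norm_sub_le _ _).trans ?_) h2)
          rw [h3]
      _ ≤ (1 + ε * M) * (‖x - y‖ + |t - s|) := by
          have : 0 ≤ ε * M * |t - s| := by positivity
          linarith
      _ ≤ L * ‖x + t • ψ x - (y + s • ψ y)‖ := by
          rw [hL, div_mul_eq_mul_div, le_div_iff₀ hc, mul_assoc, mul_comm _ c]
          gcongr
  refine ⟨ω, Φ, ε, hε, rfl, ?_, hfr, ?_, ⟨L, hL0, fun p hp q hq => ⟨?_, hlip p hp q hq⟩⟩, ?_,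
    ?_, ?_, hform⟩
  · rw [isOpen_iff_mem_nhds]
    rintro _ ⟨x, hx, t, ht, rfl⟩
    have hTn : T ∈ 𝓝 (x + t • ψ x) := by
      refine mem_interior_iff_mem_nhds.1 (hδT (mem_thickening_iff.2 ⟨x, hx, ?_⟩))
      rw [dist_eq_norm, add_sub_cancel_left, norm_smul, hunit x hx, mul_one, Real.norm_eq_abs]
      exact ht.trans_le hε2
    -- A nearby point lies in the larger tube `T`; the lower bound puts its parameter `s` within `ε
    -- - |t|` of `t`, so `|s| < ε`.
    filter_upwards [hTn, ball_mem_nhds _ (mul_pos hc (sub_pos.2 ht))]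
    rintro _ ⟨y, hy, s, hs, rfl⟩ hball
    refine hmem y hy s ?_
    rw [mem_ball, dist_eq_norm] at hball
    have h1 := (hlow y hy x hx s t hs (ht.trans_le hε1)).trans_lt hball
    have h2 := lt_of_mul_lt_mul_left h1 hc.le
    have h3 := abs_sub_abs_le_abs_sub s t
    linarith [norm_nonneg (y - x)]
  · exact InvOn.bijOn ⟨hinv, hinv⟩ hmaps hmaps
  · have := hlip _ (hmaps hp) _ (hmaps hq)
    rw [hinv p hp, hinv q hq] at this
    rw [one_div, inv_mul_le_iff₀ hL0]
    exact this
  · intro x hx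
    simpa using hform x hx 0 (by simpa using hε)
  · exact (hside₁.image_subset).antisymm fun p hp => ⟨Φ p, hside₂ hp, hinv p hp.1⟩
  · exact (hside₂.image_subset).antisymm fun p hp => ⟨Φ p, hside₁ hp, hinv p hp.1⟩

end Reflection

/-! ### Gluing outward directions into a smooth field -/

section SmoothField

open scoped Manifold ContDiff

variable {E : Type*} [NormedAddCommGroup E] [InnerProductSpace ℝ E] [FiniteDimensional ℝ E]

/-- Outward directions that are locally constant combine to a smooth field of unit outward
vectors. -/
theorem exists_contDiff_isOutward {Ω : Set E} (hΩ : IsOpen Ω) (hcpt : IsCompact (frontier Ω))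
    (h : ∀ x ∈ frontier Ω, ∃ v, IsOutward Ω x v) :
    ∃ ψ : E → E, ContDiff ℝ ∞ ψ ∧ HasCompactSupport ψ ∧
      ∀ x ∈ frontier Ω, ‖ψ x‖ = 1 ∧ IsOutward Ω x (ψ x) := by
  obtain ⟨g, hg⟩ := exists_contMDiffMap_forall_mem_convex_of_local_const 𝓘(ℝ, E) (n := ⊤)
    (t := fun x : E => {v : E | x ∈ frontier Ω → IsOutward Ω x v})
    (fun x u hu v hv a b ha hb hab hx => convex_isOutward Ω x (hu hx) (hv hx) ha hb hab)
    (fun x => by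
      by_cases hx : x ∈ frontier Ω
      · obtain ⟨v, hv⟩ := h x hx
        exact ⟨v, hv.eventually.mono fun y hy _ => hy⟩
      · refine ⟨0, ?_⟩
        filter_upwards [isClosed_frontier.isOpen_compl.mem_nhds hx] with y hy hy'
        exact absurd hy' hy)
  have hgs : ContDiff ℝ ∞ g := contMDiff_iff_contDiff.1 g.contMDiff
  have hg0 : ∀ x ∈ frontier Ω, g x ≠ 0 := by
    intro x hx
    have hx' := hx
    rw [hΩ.frontier_eq] at hx'
    exact IsOutward.ne_zero hx'.1 hx'.2 (hg x hx)
  obtain ⟨R, hR⟩ := hcpt.isBounded.subset_ball (0 : E)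
  obtain ⟨f, hf, -, hf0, hf1⟩ := exists_contMDiff_zero_iff_one_iff_of_isClosed 𝓘(ℝ, E) (n := ⊤)
    (isOpen_ball (x := (0 : E)) (ε := R)).isClosed_compl (isClosed_frontier (s := Ω))
    (disjoint_left.2 fun x hx hx' => hx (hR hx'))
  have hfs : ContDiff ℝ ∞ f := contMDiff_iff_contDiff.1 hf
  -- A smooth normaliser without zeros: `g` may vanish off the boundary, but there `f ≠ 1`. On the
  -- boundary it equals `‖g x‖ ^ 2`.
  set N : E → ℝ := fun x => ‖g x‖ ^ 2 + (1 - f x) ^ 2 with hN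
  have hN0 : ∀ x, 0 < N x := by
    intro x
    by_cases hx : x ∈ frontier Ω
    · have := norm_pos_iff.2 (hg0 x hx)
      positivity
    · have : 1 - f x ≠ 0 := fun h' => hx ((hf1 x).2 (by linarith))
      positivity
  have hNs : ContDiff ℝ ∞ N := (hgs.norm_sq ℝ).add ((contDiff_const.sub hfs).pow 2)
  refine ⟨fun x => (f x * (√(N x))⁻¹) • g x, ?_, ?_, fun x hx => ?_⟩
  · refine (hfs.mul ((hNs.sqrt fun x => (hN0 x).ne').inv fun x => ?_)).smul hgs
    exact (Real.sqrt_pos.2 (hN0 x)).ne'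
  · refine HasCompactSupport.intro (isCompact_closedBall (0 : E) R) fun x hx => ?_
    have : f x = 0 := (hf0 x).1 fun hx' => hx (ball_subset_closedBall hx')
    simp [this]
  · have h1 : f x = 1 := (hf1 x).1 hx
    have h2 : √(N x) = ‖g x‖ := by
      simp [hN, h1]
    have h3 := norm_pos_iff.2 (hg0 x hx)
    simp only [h1, h2, one_mul]
    refine ⟨?_, (hg x hx).smul (inv_pos.2 h3)⟩
    rw [norm_smul, norm_inv, norm_norm, inv_mul_cancel₀ h3.ne']

end SmoothField

/-! ### Transversality to the normal -/

section Normal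

variable {d : ℕ} {Ω : Set (EuclideanSpace ℝ (Fin d))} {x v ν : EuclideanSpace ℝ (Fin d)} {r : ℝ}

/-- The tilted vector `w = v - (r / 2) • ν` is still within `r` of `v`, so `x + t • w` leaves `Ω`.
If `⟪w, ν⟫ < 0`, that ray would start inside a cone that the normal places in `Ω`. -/
theorem HasOutwardRadius.le_inner_normal (hr : 0 < r) (h : HasOutwardRadius Ω r x v)
    (hx : x ∉ Ω) (hν : IsOuterUnitNormal Ω x ν) : r / 2 ≤ ⟪v, ν⟫ := by
  obtain ⟨hν1, hν⟩ := hν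
  set w := v - (r / 2) • ν with hw
  have hwv : ⟪w, ν⟫ = ⟪v, ν⟫ - r / 2 := by
    rw [hw, inner_sub_left, real_inner_smul_left, real_inner_self_eq_norm_sq, hν1]
    ring
  by_contra! hlt
  have hwneg : ⟪w, ν⟫ < 0 := by linarith
  set η := -⟪w, ν⟫ / (2 * (‖w‖ + 1)) with hη
  have hη0 : 0 < η := div_pos (by linarith) (by positivity)
  have hηw : η * ‖w‖ < -⟪w, ν⟫ := by
    have : η * (2 * (‖w‖ + 1)) = -⟪w, ν⟫ := by rw [hη]; field_simp
    nlinarith [norm_nonneg w]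
  have hcont : Filter.Tendsto (fun t : ℝ => x + t • w) (𝓝[>] 0) (𝓝 x) := by
    have : Continuous fun t : ℝ => x + t • w := by fun_prop
    simpa using (this.tendsto 0).mono_left nhdsWithin_le_nhds
  obtain ⟨t, ⟨ht1, -⟩, ht⟩ := ((hcont.eventually (hν η hη0)).and
    (Ioo_mem_nhdsGT hr)).exists
  have hmem : x + t • w ∈ Ω := ht1 (by
    rw [add_sub_cancel_left, real_inner_smul_left, norm_smul, Real.norm_of_nonneg ht.1.le]
    nlinarith [ht.1])
  refine h x (mem_ball_self hr) w ?_ t ht hx (subset_closure hmem)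
  rw [mem_ball, dist_eq_norm, hw, sub_sub_cancel_left, norm_neg, norm_smul, hν1, mul_one,
    Real.norm_of_nonneg (by linarith)]
  linarith

end Normal

/-! ### Graph coordinates -/

section Graph

variable {d : ℕ}

/-- The projection of `ℝ^d × ℝ` to `ℝ^d`. -/
def horizontal (z : EuclideanSpace ℝ (Fin (d + 1))) : EuclideanSpace ℝ (Fin d) :=
  WithLp.toLp 2 fun i : Fin d => z i.castSucc

/-- The point of `ℝ^d × ℝ` with the given components. -/
def verticalLift (h : EuclideanSpace ℝ (Fin d)) (s : ℝ) : EuclideanSpace ℝ (Fin (d + 1)) :=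
  WithLp.toLp 2 (Fin.snoc (α := fun _ => ℝ) h s)

@[simp] theorem horizontal_verticalLift (h : EuclideanSpace ℝ (Fin d)) (s : ℝ) :
    horizontal (verticalLift h s) = h := by
  ext i
  simp [horizontal, verticalLift]

@[simp] theorem verticalLift_last (h : EuclideanSpace ℝ (Fin d)) (s : ℝ) :
    verticalLift h s (Fin.last d) = s := by
  simp [verticalLift]

theorem verticalLift_horizontal (z : EuclideanSpace ℝ (Fin (d + 1))) :
    verticalLift (horizontal z) (z (Fin.last d)) = z := by
  ext i
  refine Fin.lastCases ?_ (fun i => ?_) i <;> simp [horizontal, verticalLift]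

theorem horizontal_add (z w : EuclideanSpace ℝ (Fin (d + 1))) :
    horizontal (z + w) = horizontal z + horizontal w := rfl

theorem horizontal_sub (z w : EuclideanSpace ℝ (Fin (d + 1))) :
    horizontal (z - w) = horizontal z - horizontal w := rfl

theorem horizontal_smul (t : ℝ) (z : EuclideanSpace ℝ (Fin (d + 1))) :
    horizontal (t • z) = t • horizontal z := rfl

theorem norm_sq_eq_horizontal (z : EuclideanSpace ℝ (Fin (d + 1))) :
    ‖z‖ ^ 2 = ‖horizontal z‖ ^ 2 + z (Fin.last d) ^ 2 := by
  rw [EuclideanSpace.norm_sq_eq, EuclideanSpace.norm_sq_eq, Fin.sum_univ_castSucc]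
  simp [horizontal]

theorem inner_eq_horizontal (z w : EuclideanSpace ℝ (Fin (d + 1))) :
    ⟪z, w⟫ = ⟪horizontal z, horizontal w⟫ + z (Fin.last d) * w (Fin.last d) := by
  rw [PiLp.inner_apply, PiLp.inner_apply, Fin.sum_univ_castSucc]
  simp [horizontal, mul_comm]

theorem norm_horizontal_le (z : EuclideanSpace ℝ (Fin (d + 1))) : ‖horizontal z‖ ≤ ‖z‖ := by
  refine abs_le_of_sq_le_sq' ?_ (norm_nonneg z) |>.2
  rw [norm_sq_eq_horizontal z]
  nlinarith [sq_nonneg (z (Fin.last d))]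

theorem abs_last_le (z : EuclideanSpace ℝ (Fin (d + 1))) : |z (Fin.last d)| ≤ ‖z‖ :=
  PiLp.norm_apply_le z (Fin.last d)

theorem norm_le_horizontal_add (z : EuclideanSpace ℝ (Fin (d + 1))) :
    ‖z‖ ≤ ‖horizontal z‖ + |z (Fin.last d)| := by
  refine abs_le_of_sq_le_sq' ?_ (by positivity) |>.2
  rw [norm_sq_eq_horizontal z, ← sq_abs (z (Fin.last d))]
  nlinarith [mul_nonneg (norm_nonneg (horizontal z)) (abs_nonneg (z (Fin.last d)))]

theorem continuous_horizontal : Continuous (horizontal (d := d)) :=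
  LipschitzWith.continuous (K := 1) <| LipschitzWith.of_dist_le_mul fun z w => by
    rw [dist_eq_norm, dist_eq_norm, ← horizontal_sub, NNReal.coe_one, one_mul]
    exact norm_horizontal_le _

theorem lipschitzWith_graph {G : EuclideanSpace ℝ (Fin d) → ℝ} {K : NNReal}
    (hG : LipschitzWith K G) : LipschitzWith (1 + K) fun h => verticalLift h (G h) :=
  LipschitzWith.of_dist_le_mul fun h k => by
    rw [dist_eq_norm]
    refine (norm_le_horizontal_add _).trans ?_
    have := hG.dist_le_mul h k
    rw [Real.dist_eq] at this
    rw [horizontal_sub, horizontal_verticalLift, horizontal_verticalLift, PiLp.sub_apply,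
      verticalLift_last, verticalLift_last, ← dist_eq_norm]
    push_cast
    linarith

/-- In the coordinates `y = x + L z`, the set `Ω` is in `B_r(x)` the region below the graph
of `G`. -/
def IsGraphChart (Ω : Set (EuclideanSpace ℝ (Fin (d + 1)))) (x : EuclideanSpace ℝ (Fin (d + 1)))
    (r : ℝ) (G : EuclideanSpace ℝ (Fin d) → ℝ)
    (L : EuclideanSpace ℝ (Fin (d + 1)) ≃ₗᵢ[ℝ] EuclideanSpace ℝ (Fin (d + 1))) : Prop :=
  ∀ y ∈ ball x r, y ∈ Ω ↔ L.symm (y - x) (Fin.last d) < G (horizontal (L.symm (y - x)))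

/-- By Mazur–Ulam the isometry is affine; its linear part is `L`, and its value at `0` is `x`. -/
theorem IsLipschitzSet.exists_isGraphChart {Ω : Set (EuclideanSpace ℝ (Fin (d + 1)))}
    (hΩ : IsLipschitzSet Ω) {x : EuclideanSpace ℝ (Fin (d + 1))} (hx : x ∈ frontier Ω) :
    ∃ r : ℝ, 0 < r ∧ ∃ G K, LipschitzWith K G ∧ ∃ L, IsGraphChart Ω x r G L := by
  obtain ⟨r, hr, G, ⟨K, hK⟩, A, hA0, hA⟩ := hΩ x hx
  set B := A.toRealAffineIsometryEquiv with hB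
  have hAL : ∀ z, A z = x + B.linearIsometryEquiv z := by
    intro z
    have := B.map_vadd 0 z
    rw [vadd_eq_add, add_zero, vadd_eq_add] at this
    have hBA : ∀ z, B z = A z := fun z => by rw [hB, A.coeFn_toRealAffineIsometryEquiv]
    rw [hBA, hBA, hA0] at this
    exact this.trans (add_comm _ _)
  refine ⟨r, hr, G, K, hK, B.linearIsometryEquiv, fun y hy => ?_⟩
  have h1 : y ∈ Ω ↔ y ∈ A '' subgraph G := by
    have := Set.ext_iff.1 hA y
    simpa only [mem_inter_iff, hy, true_and] using this
  rw [h1]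
  set z := B.linearIsometryEquiv.symm (y - x) with hz
  have hyz : A z = y := by
    rw [hAL, hz, LinearIsometryEquiv.apply_symm_apply, add_sub_cancel]
  rw [← hyz, A.injective.mem_set_image]
  rfl

/-! ### Outward direction and normals in a graph chart -/

namespace IsGraphChart

variable {Ω : Set (EuclideanSpace ℝ (Fin (d + 1)))} {x : EuclideanSpace ℝ (Fin (d + 1))}
  {r : ℝ} {G : EuclideanSpace ℝ (Fin d) → ℝ}
  {L : EuclideanSpace ℝ (Fin (d + 1)) ≃ₗᵢ[ℝ] EuclideanSpace ℝ (Fin (d + 1))}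

theorem continuous_height (hG : Continuous G) (x : EuclideanSpace ℝ (Fin (d + 1)))
    (L : EuclideanSpace ℝ (Fin (d + 1)) ≃ₗᵢ[ℝ] EuclideanSpace ℝ (Fin (d + 1))) :
    Continuous fun y => L.symm (y - x) (Fin.last d) - G (horizontal (L.symm (y - x))) := by
  have h1 : Continuous fun y => L.symm (y - x) := by fun_prop
  exact (by fun_prop : Continuous fun y => L.symm (y - x) (Fin.last d)).sub
    (hG.comp (continuous_horizontal.comp h1))

theorem notMem_closure (h : IsGraphChart Ω x r G L) (hG : Continuous G)
    {y : EuclideanSpace ℝ (Fin (d + 1))} (hy : y ∈ ball x r)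
    (hlt : G (horizontal (L.symm (y - x))) < L.symm (y - x) (Fin.last d)) : y ∉ closure Ω := by
  rw [mem_closure_iff_frequently, Filter.not_frequently]
  filter_upwards [isOpen_ball.mem_nhds hy,
    (continuous_height hG x L).continuousAt.eventually (lt_mem_nhds (sub_pos.2 hlt))] with z hz hz'
  rw [h z hz]
  exact (sub_pos.1 hz').not_gt

theorem mem_interior (h : IsGraphChart Ω x r G L) (hG : Continuous G)
    {y : EuclideanSpace ℝ (Fin (d + 1))} (hy : y ∈ ball x r) (hmem : y ∈ Ω) :
    y ∈ interior Ω := by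
  rw [mem_interior_iff_mem_nhds]
  filter_upwards [isOpen_ball.mem_nhds hy, (continuous_height hG x L).continuousAt.eventually
    (gt_mem_nhds (sub_neg.2 ((h y hy).1 hmem)))] with z hz hz'
  exact (h z hz).2 (sub_neg.1 hz')

theorem height_eq (h : IsGraphChart Ω x r G L) (hG : Continuous G)
    {y : EuclideanSpace ℝ (Fin (d + 1))} (hy : y ∈ ball x r) (hfr : y ∈ frontier Ω) :
    L.symm (y - x) (Fin.last d) = G (horizontal (L.symm (y - x))) := by
  refine le_antisymm (not_lt.1 fun hlt => h.notMem_closure hG hy hlt hfr.1)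
    (not_lt.1 fun hlt => hfr.2 (h.mem_interior hG hy ((h y hy).2 hlt)))

/-- Along `w` near the vertical, the height grows at rate above `1 - ρ` while the graph rises at
rate at most `K * ρ`, so a point on or above the graph moves strictly above it. -/
theorem isOutward (h : IsGraphChart Ω x r G L) (hr : 0 < r) {K : NNReal}
    (hG : LipschitzWith K G) : IsOutward Ω x (L (verticalLift 0 1)) := by
  -- The first bound gives `K * ρ < 1 - ρ`; the second keeps `z + t • w` in the chart ball.
  set ρ : ℝ := min (1 / (K + 2)) (r / 3) with hρ
  have hρ0 : 0 < ρ := by positivity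
  have hρr : ρ ≤ r / 3 := min_le_right _ _
  have hρK : ρ * (K + 2) ≤ 1 := by
    rw [← le_div_iff₀ (by positivity)]
    exact min_le_left _ _
  have hK0 := K.coe_nonneg
  refine ⟨ρ, hρ0, fun z hz w hw t ht hzΩ => ?_⟩
  set e : EuclideanSpace ℝ (Fin (d + 1)) := verticalLift 0 1 with he
  have hnorm : ‖e‖ ≤ 1 := (norm_le_horizontal_add e).trans (by simp [he])
  rw [mem_ball, dist_eq_norm] at hz hw
  set u := L.symm w with hu
  have hue : ‖u - e‖ < ρ := by
    rwa [← L.symm_apply_apply e, hu, ← map_sub, L.symm.norm_map]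
  have hul : 1 - ρ < u (Fin.last d) := by
    have := (abs_last_le (u - e)).trans_lt hue
    rw [PiLp.sub_apply, he, verticalLift_last] at this
    linarith [(abs_lt.1 this).1]
  have huh : ‖horizontal u‖ < ρ := by
    have := (norm_horizontal_le (u - e)).trans_lt hue
    rwa [horizontal_sub, he, horizontal_verticalLift, sub_zero] at this
  have hw1 : ‖w‖ ≤ 1 + ρ := by
    rw [← L.symm.norm_map w]
    have := norm_add_le e (u - e)
    rw [add_sub_cancel] at this
    linarith
  have hzball : z ∈ ball x r := by
    rw [mem_ball, dist_eq_norm]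
    linarith
  have hball : z + t • w ∈ ball x r := by
    rw [mem_ball, dist_eq_norm, add_sub_right_comm]
    have h1 : ‖t • w‖ ≤ ρ * (1 + ρ) := by
      rw [norm_smul, Real.norm_of_nonneg ht.1.le]
      gcongr
      exact ht.2.le
    nlinarith [norm_add_le (z - x) (t • w)]
  refine h.notMem_closure hG.continuous hball ?_
  have hcoord : L.symm (z + t • w - x) = L.symm (z - x) + t • u := by
    rw [hu, ← map_smul, ← map_add]
    congr 1
    abel
  have hzG : G (horizontal (L.symm (z - x))) ≤ L.symm (z - x) (Fin.last d) :=
    not_lt.1 fun hlt => hzΩ ((h z hzball).2 hlt)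
  rw [hcoord, horizontal_add, horizontal_smul, PiLp.add_apply, PiLp.smul_apply, smul_eq_mul]
  have hlip := hG.dist_le_mul (horizontal (L.symm (z - x)) + t • horizontal u)
    (horizontal (L.symm (z - x)))
  rw [dist_eq_norm (horizontal (L.symm (z - x)) + t • horizontal u), add_sub_cancel_left,
    norm_smul, Real.norm_of_nonneg ht.1.le, Real.dist_eq] at hlip
  have h2 : K * (t * ‖horizontal u‖) ≤ t * (K * ρ) := by
    have : K * ‖horizontal u‖ ≤ K * ρ := by gcongr
    nlinarith [ht.1]
  have h3 : t * (K * ρ) < t * u (Fin.last d) := by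
    refine mul_lt_mul_of_pos_left ?_ ht.1
    linarith
  linarith [(abs_le.1 hlip).2]

/-- The normal is `(-∇G, 1)` normalised: its product with `z - y` is, up to the factor `‖n‖⁻¹` and
the differentiability error, the height of `z` above the graph. As `‖n‖ ≥ 1`, that error fits in the
cone of the same aperture `η`. -/
theorem exists_isOuterUnitNormal (h : IsGraphChart Ω x r G L) (hG : Continuous G)
    {y : EuclideanSpace ℝ (Fin (d + 1))} (hy : y ∈ ball x r) (hfr : y ∈ frontier Ω)
    (hdiff : DifferentiableAt ℝ G (horizontal (L.symm (y - x)))) :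
    ∃ ν, IsOuterUnitNormal Ω y ν := by
  set g := gradient G (horizontal (L.symm (y - x))) with hg
  set n : EuclideanSpace ℝ (Fin (d + 1)) := verticalLift (-g) 1 with hn
  have hn1 : 1 ≤ ‖n‖ := by simpa [hn] using abs_last_le n
  have hn0 : 0 < ‖n‖ := by linarith
  refine ⟨‖n‖⁻¹ • L n, ?_, fun η hη => ?_⟩
  · rw [norm_smul, L.norm_map, norm_inv, norm_norm, inv_mul_cancel₀ hn0.ne']
  have hgrad := (hasGradientAt_iff_isLittleO.1 hdiff.hasGradientAt).def hη
  have hcont : Continuous fun z => horizontal (L.symm (z - x)) :=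
    continuous_horizontal.comp (by fun_prop)
  filter_upwards [(hcont.tendsto y).eventually hgrad, isOpen_ball.mem_nhds hy] with z hz hzball
  rw [← hg] at hz
  have hsub : L.symm (z - y) = L.symm (z - x) - L.symm (y - x) := by
    rw [← map_sub]
    congr 1
    abel
  set Δ := L.symm (z - y) with hΔ
  have hΔn : ‖z - y‖ = ‖Δ‖ := (L.symm.norm_map _).symm
  have hinner : ⟪z - y, ‖n‖⁻¹ • L n⟫ = ‖n‖⁻¹ * (Δ (Fin.last d) - ⟪g, horizontal Δ⟫) := by
    rw [real_inner_smul_right, ← L.symm.inner_map_map, L.symm_apply_apply, ← hΔ,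
      inner_eq_horizontal, hn, horizontal_verticalLift, verticalLift_last, inner_neg_right,
      real_inner_comm]
    ring
  have hlast : Δ (Fin.last d) =
      L.symm (z - x) (Fin.last d) - G (horizontal (L.symm (y - x))) := by
    rw [hsub, PiLp.sub_apply, h.height_eq hG hy hfr]
  rw [← horizontal_sub, ← hsub, Real.norm_eq_abs] at hz
  obtain ⟨hz1, hz2⟩ := abs_le.1 hz
  have hle : η * ‖horizontal Δ‖ ≤ ‖n‖ * (η * ‖Δ‖) := by
    have h1 : η * ‖horizontal Δ‖ ≤ η * ‖Δ‖ := by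
      gcongr
      exact norm_horizontal_le _
    have h2 : 0 ≤ η * ‖Δ‖ := by positivity
    nlinarith
  rw [hinner, hΔn]
  constructor
  · intro hlt
    rw [inv_mul_lt_iff₀ hn0] at hlt
    exact (h z hzball).2 (by linarith)
  · intro hlt
    rw [lt_inv_mul_iff₀ hn0] at hlt
    exact fun hmem => absurd ((h z hzball).1 hmem) (by linarith)

open MeasureTheory in
-- Points without a normal lie over the non-differentiability set of `G`, null by Rademacher. The
-- Lipschitz graph map preserves null sets of the `d`-dimensional Hausdorff measure, which on `ℝ^d`
-- is a Haar measure.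
theorem hausdorffMeasure_no_normal (h : IsGraphChart Ω x r G L) {K : NNReal}
    (hG : LipschitzWith K G) :
    Measure.hausdorffMeasure (d : ℝ)
      {y | y ∈ ball x r ∧ y ∈ frontier Ω ∧ ¬ ∃ ν, IsOuterUnitNormal Ω y ν} = 0 := by
  set D : Set (EuclideanSpace ℝ (Fin d)) := {p | ¬ DifferentiableAt ℝ G p} with hD
  have hD0 : Measure.hausdorffMeasure (d : ℝ) D = 0 := by
    have hhaar := isAddHaarMeasure_hausdorffMeasure (E := EuclideanSpace ℝ (Fin d))
    rw [finrank_euclideanSpace_fin] at hhaar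
    exact ae_iff.1 (hG.ae_differentiableAt (μ := Measure.hausdorffMeasure (d : ℝ)))
  set Γ : EuclideanSpace ℝ (Fin d) → EuclideanSpace ℝ (Fin (d + 1)) :=
    fun p => x + L (verticalLift p (G p)) with hΓ
  have hlip : LipschitzWith (1 + K) Γ := LipschitzWith.of_dist_le_mul fun p q => by
    rw [hΓ, dist_add_left, L.dist_map]
    exact (lipschitzWith_graph hG).dist_le_mul p q
  have himage : Measure.hausdorffMeasure (d : ℝ) (Γ '' D) = 0 := by
    have := hlip.hausdorffMeasure_image_le (Nat.cast_nonneg d) D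
    rw [hD0, mul_zero] at this
    exact nonpos_iff_eq_zero.1 this
  refine measure_mono_null ?_ himage
  rintro y ⟨hy, hfr, hno⟩
  refine ⟨horizontal (L.symm (y - x)), fun hdiff =>
    hno (h.exists_isOuterUnitNormal hG.continuous hy hfr hdiff), ?_⟩
  rw [hΓ]
  dsimp only
  rw [← h.height_eq hG.continuous hy hfr, verticalLift_horizontal, L.apply_symm_apply,
    add_sub_cancel]

end IsGraphChart

/-! ### Global consequences of the charts -/

namespace IsLipschitzSet

variable {Ω : Set (EuclideanSpace ℝ (Fin (d + 1)))}

/-- The strict inequality in the subgraph excludes boundary points: a chart centred at one that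
belonged to `Ω` would make it interior. -/
theorem isOpen (hΩ : IsLipschitzSet Ω) : IsOpen Ω := by
  rw [← subset_interior_iff_isOpen]
  intro x hx
  by_contra hn
  obtain ⟨r, hr, G, K, hG, L, h⟩ := hΩ.exists_isGraphChart ⟨subset_closure hx, hn⟩
  exact hn (h.mem_interior hG.continuous (mem_ball_self hr) hx)

open MeasureTheory in
theorem ae_exists_isOuterUnitNormal (hΩ : IsLipschitzSet Ω) :
    ∀ᵐ x ∂(Measure.hausdorffMeasure (d : ℝ) : Measure (EuclideanSpace ℝ (Fin (d + 1)))),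
      x ∈ frontier Ω → ∃ ν, IsOuterUnitNormal Ω x ν := by
  rw [ae_iff]
  refine measure_null_of_locally_null _ fun x hx => ?_
  obtain ⟨r, hr, G, K, hG, L, h⟩ := hΩ.exists_isGraphChart (Classical.not_imp.1 hx).1
  refine ⟨_, inter_mem_nhdsWithin _ (ball_mem_nhds x hr),
    measure_mono_null ?_ (h.hausdorffMeasure_no_normal hG)⟩
  rintro y ⟨hy, hyb⟩
  exact ⟨hyb, (Classical.not_imp.1 hy).1, (Classical.not_imp.1 hy).2⟩

end IsLipschitzSet

end Graph

theorem theorem3p1 (d : ℕ) (Ω : Set (EuclideanSpace ℝ (Fin (d + 1))))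
    (hΩ : IsLipschitzSet Ω) (hb : Bornology.IsBounded Ω) :
    ∃ (ω : Set (EuclideanSpace ℝ (Fin (d + 1))))
      (Φ : EuclideanSpace ℝ (Fin (d + 1)) → EuclideanSpace ℝ (Fin (d + 1))),
      IsOpen ω ∧ frontier Ω ⊆ ω ∧
      Set.BijOn Φ ω ω ∧ IsBilipschitzOn Φ ω ∧
      (∀ x ∈ frontier Ω, Φ x = x) ∧
      Φ '' (ω ∩ Ω) = ω \ closure Ω ∧ Φ '' (ω \ closure Ω) = ω ∩ Ω ∧
      ∃ (ψ : EuclideanSpace ℝ (Fin (d + 1)) → EuclideanSpace ℝ (Fin (d + 1))) (ε : ℝ),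
        IsSmoothTransversalField Ω ψ ∧ 0 < ε ∧
        ω = {y | ∃ x ∈ frontier Ω, ∃ t : ℝ, |t| < ε ∧ y = x + t • ψ x} ∧
        ∀ x ∈ frontier Ω, ∀ t : ℝ, |t| < ε → Φ (x + t • ψ x) = x - t • ψ x := by
  have hopen := hΩ.isOpen
  have hcpt : IsCompact (frontier Ω) :=
    hb.isCompact_closure.of_isClosed_subset isClosed_frontier frontier_subset_closure
  obtain ⟨ψ, hψs, hψc, hψ⟩ := exists_contDiff_isOutward hopen hcpt fun x hx => by
    obtain ⟨r, hr, G, K, hG, L, h⟩ := hΩ.exists_isGraphChart hx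
    exact ⟨_, h.isOutward hr hG⟩
  obtain ⟨M, hM⟩ := hψs.lipschitzWith_of_hasCompactSupport hψc (by simp)
  obtain ⟨B, hB⟩ := hψc.exists_bound_of_continuous hψs.continuous
  obtain ⟨ω, Φ, ε, hε, hω, hωo, hfr, hbij, hbilip, hfix, h₁, h₂, hform⟩ :=
    exists_reflection hopen hcpt hM hB (fun x hx => (hψ x hx).1) fun x hx => (hψ x hx).2
  -- A radius valid on the whole boundary supplies the uniform constant `γ = r / 2`.
  obtain ⟨r, hr, hrad⟩ := exists_uniform_hasOutwardRadius hcpt hψs.continuous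
    fun x hx => (hψ x hx).2
  refine ⟨ω, Φ, hωo, hfr, hbij, hbilip, hfix, h₁, h₂, ψ, ε,
    ⟨hψs, hψc, fun x hx => (hψ x hx).1, r / 2, half_pos hr, ?_⟩, hε, hω, hform⟩
  rw [MeasureTheory.ae_restrict_iff' isClosed_frontier.measurableSet, Nat.cast_add_one,
    add_sub_cancel_right]
  filter_upwards [hΩ.ae_exists_isOuterUnitNormal] with x hx hxfr
  obtain ⟨ν, hν⟩ := hx hxfr
  have hx' := hxfr
  rw [hopen.frontier_eq] at hx'
  exact ⟨ν, hν, (hrad x hxfr).le_inner_normal hr hx'.2 hν⟩
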